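/- **Definitions.** Let $d\ge 1$ and let $Q$ be a positive definite quadratic form on $\mathbb{R}^d$, so that $Q[x]=x^tQx=\|Ax\|^2$ with $A\in \mathrm{GL}_d(\mathbb{R})$, $Q=A^tA$. A $d$-dimensional simplex $L=\operatorname{conv}\{v_0,\dots,v_d\}$ with vertices $v_0,\dots,v_d\in\mathbb{Z}^d$ is a *Delone simplex* of $Q$ (equivalently, of the lattice $\Lambda=A\mathbb{Z}^d$) if there are $c\in\mathbb{R}^d$ and $r>0$ such that $Q[x-c]\ge r^2$ for all $x\in\mathbb{Z}^d$, with equality if and only if $x\in\{v_0,\dots,v_d\}$. The *relative volume* of $L$ is $\operatorname{vol}(L)$ divided by the volume of the unimodular simplex $\operatorname{conv}\{0,e_1,\dots,e_d\}$ of $\mathbb{Z}^d$, that is, $d!\cdot\operatorname{vol}(L)$. Let $\mathrm{mv}(d)$ be the maximum relative volume of a $d$-dimensional Delone simplex, over all positive definite quadratic forms in $d$ variables (equivalently, over all lattices of rank $d$ in $\mathbb{R}^d$). **Corollary.** For every $d\ge 1$ the maximum defining $\mathrm{mv}(d)$ exists (the set of relative volumes is non-empty, bounded, and its supremum is attained).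 As $d\to\infty$, $$\log \mathrm{mv}(d)\in\Theta(d\log d),$$ that is, there are constants $0<c_1\le c_2$ and $d_0$ such that $c_1\, d\log d\le \log \mathrm{mv}(d)\le c_2\, d\log d$ for all $d\ge d_0$. Moreover, for every $d\ge 1$, $$\mathrm{mv}(d)\le \frac{2^d\, d!}{\binom{2d}{d}}.$$ -/

import Mathlib

noncomputable section

namespace Delone

/-- The inclusion `ℤ^d ⊆ ℝ^d`. -/
def toReal {d : ℕ} (x : Fin d → ℤ) : Fin d → ℝ := fun i => (x i : ℝ)

/-- The value `Q[x] = xᵗ Q x` of the quadratic form with matrix `Q`. -/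
def quadValue {d : ℕ} (Q : Matrix (Fin d) (Fin d) ℝ) (x : Fin d → ℝ) : ℝ := x ⬝ᵥ Q.mulVec x

/-- `v 0, …, v d` are the vertices of a `d`-dimensional Delone simplex of the form `Q`
(with `Q = Aᵗ A` positive definite; equivalently, of the lattice `A ℤ^d`): they are affinely
independent points of `ℤ^d`, and some ellipsoid `Q[x - c] = r ^ 2` has no points of `ℤ^d` in its
interior, and on its boundary exactly the points `v 0, …, v d`. -/
def IsDeloneSimplex {d : ℕ} (Q : Matrix (Fin d) (Fin d) ℝ) (v : Fin (d + 1) → Fin d → ℤ) : Prop :=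
  AffineIndependent ℝ (fun i => toReal (v i)) ∧
    ∃ (c : Fin d → ℝ) (r : ℝ), 0 < r ∧
      ∀ x : Fin d → ℤ, r ^ 2 ≤ quadValue Q (toReal x - c) ∧
        (quadValue Q (toReal x - c) = r ^ 2 ↔ ∃ i, x = v i)

/-- The unimodular simplex `conv {0, e₁, …, e_d}` of the lattice `ℤ^d`. -/
def unimodularSimplex (d : ℕ) : Set (Fin d → ℝ) :=
  convexHull ℝ (insert 0 (Set.range fun i : Fin d => Pi.single i (1 : ℝ)))

/-- The relative volume of `conv {v 0, …, v d}`: its volume divided by the volume of a unimodular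
simplex of `ℤ^d`. -/
def relVolume {d : ℕ} (v : Fin (d + 1) → Fin d → ℤ) : ℝ :=
  (MeasureTheory.volume (convexHull ℝ (Set.range fun i => toReal (v i)))).toReal /
    (MeasureTheory.volume (unimodularSimplex d)).toReal

/-- The set of relative volumes of all `d`-dimensional Delone simplices, over all positive
definite quadratic forms in `d` variables. -/
def relVolumes (d : ℕ) : Set ℝ :=
  {t | ∃ Q : Matrix (Fin d) (Fin d) ℝ, Q.PosDef ∧
    ∃ v : Fin (d + 1) → Fin d → ℤ, IsDeloneSimplex Q v ∧ relVolume v = t}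

/-- The maximum relative volume of `d`-dimensional Delone simplices. -/
def mv (d : ℕ) : ℝ := sSup (relVolumes d)

end Delone

end

/-! Upper bound: since the circumscribed ellipsoid of a Delone simplex L is empty, the interior of L
- L contains no nonzero lattice point (`IsDeloneSimplex.eq_zero_of_mem_image`), so Minkowski's
theorem gives vol(L - L) ≤ 2^d. For a simplex vol(L - L) = binom(2d, d) vol(L), of which only ≥ is
needed (`le_volume_differenceBody`).

Attainment: a relative volume is the absolute determinant of an integer edge matrix, so a bounded
set of relative volumes is finite.

Lower bound: for d = 2^k - 1 take the integer vectors that reduce mod 2 to words of the binary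
simplex code. The sphere around the unit cube meets this lattice exactly in the d + 1 codewords. The
matrix C of nonzero codewords satisfies 4C² = 2^k (I + J) with J all ones, so |det C| =
(d+1)^((d+1)/2) / 2^d, while the lattice has index at most 2^d (`exists_large_relVolume`). Pyramids
carry a relative volume to every higher dimension (`relVolumes_mono`), and each d is within a factor
of about 2 of some 2^k - 1. -/

noncomputable section

namespace Delone

open MeasureTheory

/-! ### Relative volume as a determinant -/

/-- The integer matrix whose rows are the edge vectors `v (i + 1) - v 0`. -/
def edgeMatrix {d : ℕ} (v : Fin (d + 1) → Fin d → ℤ) : Matrix (Fin d) (Fin d) ℤ :=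
  Matrix.of fun i j => v i.succ j - v 0 j

/-- The edge matrix with real entries. -/
def realEdgeMatrix {d : ℕ} (v : Fin (d + 1) → Fin d → ℤ) : Matrix (Fin d) (Fin d) ℝ :=
  (edgeMatrix v).map (Int.castRingHom ℝ)

lemma det_realEdgeMatrix {d : ℕ} (v : Fin (d + 1) → Fin d → ℤ) :
    (realEdgeMatrix v).det = ((edgeMatrix v).det : ℝ) := by
  simpa [realEdgeMatrix, RingHom.mapMatrix_apply] using
    ((Int.castRingHom ℝ).map_det (edgeMatrix v)).symm

lemma realEdgeMatrix_apply {d : ℕ} (v : Fin (d + 1) → Fin d → ℤ) (i j : Fin d) :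
    realEdgeMatrix v i j = (v i.succ j : ℝ) - v 0 j := by
  simp [realEdgeMatrix, edgeMatrix]

lemma affineIndependent_iff_det_edgeMatrix_ne_zero {d : ℕ} (v : Fin (d + 1) → Fin d → ℤ) :
    AffineIndependent ℝ (fun i => toReal (v i)) ↔ (edgeMatrix v).det ≠ 0 := by
  rw [affineIndependent_iff_linearIndependent_vsub ℝ _ (0 : Fin (d + 1)),
    ← linearIndependent_equiv (finSuccAboveEquiv (0 : Fin (d + 1)))]
  have h : (fun i : {x : Fin (d + 1) // x ≠ 0} => toReal (v i) -ᵥ toReal (v 0)) ∘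
      (finSuccAboveEquiv (0 : Fin (d + 1))) = (realEdgeMatrix v).row := by
    funext i j
    simp [realEdgeMatrix_apply, toReal, Matrix.row, finSuccAboveEquiv_apply]
  rw [h, Matrix.linearIndependent_rows_iff_isUnit, Matrix.isUnit_iff_isUnit_det,
    det_realEdgeMatrix, isUnit_iff_ne_zero]
  exact Int.cast_ne_zero

/-- The convex hull of the vertices is an affine image of the unimodular simplex. -/
lemma convexHull_vertices_eq_image {d : ℕ} (v : Fin (d + 1) → Fin d → ℤ) :
    convexHull ℝ (Set.range fun i => toReal (v i)) =
      (fun x => toReal (v 0) + x) ''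
        (Matrix.toLin' (realEdgeMatrix v).transpose '' unimodularSimplex d) := by
  rw [unimodularSimplex, LinearMap.image_convexHull]
  have h := AffineMap.image_convexHull (𝕜 := ℝ)
    (AffineEquiv.constVAdd ℝ (Fin d → ℝ) (toReal (v 0)) : (Fin d → ℝ) →ᵃ[ℝ] (Fin d → ℝ))
    (Matrix.toLin' (realEdgeMatrix v).transpose ''
      insert 0 (Set.range fun i : Fin d => Pi.single i (1 : ℝ)))
  have h' : (fun x => toReal (v 0) + x) =
    ⇑(AffineEquiv.constVAdd ℝ (Fin d → ℝ) (toReal (v 0)) : (Fin d → ℝ) →ᵃ[ℝ] (Fin d → ℝ)) := by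
    ext; simp
  rw [h', h]
  congr 1
  rw [← h', Set.image_insert_eq, Set.image_insert_eq, ← Set.range_comp, ← Set.range_comp,
    Fin.range_fin_succ]
  congr 1
  · simp
  · congr 1
    ext i j
    simp [Fin.tail, toReal, realEdgeMatrix_apply]

lemma volume_unimodularSimplex_ne_top (d : ℕ) : volume (unimodularSimplex d) ≠ ⊤ := by
  refine (IsCompact.measure_lt_top ?_).ne
  exact (((Set.finite_range _).insert 0).isCompact_convexHull ℝ)

lemma mem_unimodularSimplex {d : ℕ} {x : Fin d → ℝ} (h0 : ∀ i, 0 ≤ x i) (h1 : ∑ i, x i ≤ 1) :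
    x ∈ unimodularSimplex d := by
  have h : ∑ i : Option (Fin d), (i.elim (1 - ∑ i, x i) x) •
      (i.elim (0 : Fin d → ℝ) fun i => Pi.single i 1) ∈ unimodularSimplex d := by
    refine (convex_convexHull ℝ _).sum_mem ?_ ?_ ?_
    · rintro (_ | i) -
      · simpa using h1
      · exact h0 i
    · simp [Fintype.sum_option]
    · rintro (_ | i) -
      · exact subset_convexHull ℝ _ (by simp)
      · exact subset_convexHull ℝ _ (by simp)
  convert h
  ext j
  simp [Fintype.sum_option, Finset.sum_apply, Pi.single_apply]

lemma volume_unimodularSimplex_ne_zero (d : ℕ) : volume (unimodularSimplex d) ≠ 0 := by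
  -- The side 1 / (d + 1), rather than 1 / d, stays positive for d = 0.
  have hsub : Set.pi Set.univ (fun _ : Fin d => Set.Ioo (0 : ℝ) (1 / (d + 1))) ⊆
      unimodularSimplex d := by
    intro x hx
    refine mem_unimodularSimplex (fun i => (hx i trivial).1.le) ?_
    calc ∑ i, x i ≤ ∑ _i : Fin d, (1 / (d + 1) : ℝ) :=
          Finset.sum_le_sum fun i _ => (hx i trivial).2.le
      _ ≤ 1 := by
        rw [Finset.sum_const, Finset.card_univ, Fintype.card_fin, nsmul_eq_mul,
          mul_one_div, div_le_one (by positivity)]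
        linarith
  intro h
  have h0 := measure_mono_null hsub h
  rw [volume_pi_pi] at h0
  simp only [Real.volume_Ioo, Finset.prod_const, sub_zero] at h0
  refine pow_ne_zero _ ?_ h0
  simp only [ne_eq, ENNReal.ofReal_eq_zero, not_le]
  positivity

/-- The relative volume of a lattice simplex is the absolute determinant of its edge matrix. -/
lemma relVolume_eq_abs_det {d : ℕ} (v : Fin (d + 1) → Fin d → ℤ) :
    relVolume v = |((edgeMatrix v).det : ℝ)| := by
  rw [relVolume, convexHull_vertices_eq_image, Set.image_add_left, measure_preimage_add,
    Measure.addHaar_image_linearMap, LinearMap.det_toLin', Matrix.det_transpose,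
    det_realEdgeMatrix, ENNReal.toReal_mul, ENNReal.toReal_ofReal (abs_nonneg _),
    mul_div_assoc, div_self, mul_one]
  exact (ENNReal.toReal_pos (volume_unimodularSimplex_ne_zero d)
    (volume_unimodularSimplex_ne_top d)).ne'

/-! ### Volume of the difference body -/

/-- The open corner simplex of `ℝ^ι`. -/
def cornerSimplex (ι : Type*) [Fintype ι] : Set (ι → ℝ) := {x | (∀ i, 0 < x i) ∧ ∑ i, x i < 1}

lemma volume_crossPolytope (ι : Type*) [Fintype ι] :
    volume {x : ι → ℝ | ∑ i, |x i| < 1} =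
      ENNReal.ofReal (2 ^ Fintype.card ι / (Fintype.card ι).factorial) := by
  have h := volume_sum_rpow_lt_one ι (p := 1) le_rfl
  norm_num [Real.Gamma_nat_eq_factorial] at h
  exact h

/-- Coordinatewise multiplication by signs preserves the volume. -/
lemma volume_image_signs {ι : Type*} [Fintype ι] (σ : ι → ℤˣ) (s : Set (ι → ℝ)) :
    volume ((fun x i => ((σ i : ℤ) : ℝ) * x i) '' s) = volume s := by
  classical
  have h : (fun (x : ι → ℝ) i => ((σ i : ℤ) : ℝ) * x i) =
      Matrix.toLin' (Matrix.diagonal fun i => ((σ i : ℤ) : ℝ)) := by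
    ext x i; simp [Matrix.mulVec_diagonal]
  rw [h, Measure.addHaar_image_linearMap, LinearMap.det_toLin', Matrix.det_diagonal,
    Finset.abs_prod, Finset.prod_eq_one, ENNReal.ofReal_one, one_mul]
  intro i _
  rcases Int.units_eq_one_or (σ i) with h | h <;> simp [h]

/-- Up to coordinate hyperplanes, the 2^n sign reflections of the corner simplex cover the
cross-polytope, whose volume is 2^n / n!. -/
lemma le_volume_cornerSimplex (ι : Type*) [Fintype ι] :
    ENNReal.ofReal (1 / (Fintype.card ι).factorial) ≤ volume (cornerSimplex ι) := by
  classical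
  have hcover : {x : ι → ℝ | ∑ i, |x i| < 1} ⊆
      (⋃ σ : ι → ℤˣ, (fun x i => ((σ i : ℤ) : ℝ) * x i) '' cornerSimplex ι) ∪
        ⋃ i, {x : ι → ℝ | x i = 0} := by
    intro x hx
    by_cases h0 : ∃ i, x i = 0
    · exact Or.inr (by simpa using h0)
    · push Not at h0
      refine Or.inl (Set.mem_iUnion.2 ⟨fun i => if 0 < x i then 1 else -1,
        fun i => |x i|, ⟨fun i => abs_pos.2 (h0 i), hx⟩, ?_⟩)
      funext i
      by_cases hi : 0 < x i
      · simp [hi, abs_of_pos hi]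
      · simp [hi, abs_of_nonpos (not_lt.1 hi)]
  have hnull : volume (⋃ i, {x : ι → ℝ | x i = 0}) = 0 :=
    measure_iUnion_null fun i => Measure.pi_hyperplane (fun _ => volume) i 0
  have h1 : volume {x : ι → ℝ | ∑ i, |x i| < 1} ≤
      2 ^ Fintype.card ι * volume (cornerSimplex ι) := by
    calc _ ≤ _ := measure_mono hcover
      _ ≤ _ := measure_union_le _ _
      _ = volume (⋃ σ : ι → ℤˣ, (fun x i => ((σ i : ℤ) : ℝ) * x i) '' cornerSimplex ι) := by
        rw [hnull, add_zero]
      _ ≤ _ := measure_iUnion_fintype_le _ _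
      _ = _ := by simp [volume_image_signs]
  rw [volume_crossPolytope, div_eq_mul_one_div, ENNReal.ofReal_mul (by positivity),
    ENNReal.ofReal_pow (by norm_num)] at h1
  rw [ENNReal.ofReal_ofNat] at h1
  exact (ENNReal.mul_le_mul_iff_right (by simp) (by simp)).1 h1

/-- The interior of the difference body of the unimodular simplex. -/
def differenceBody (ι : Type*) [Fintype ι] : Set (ι → ℝ) :=
  {x | ∑ i, max (x i) 0 < 1 ∧ ∑ i, max (-x i) 0 < 1}

/-- The points of the difference body that are positive on `I` and negative off `I`. -/
def orthantPiece {ι : Type*} [Fintype ι] [DecidableEq ι] (I : Finset ι) : Set (ι → ℝ) :=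
  {x | ((∀ i ∈ I, 0 < x i) ∧ ∑ i ∈ I, x i < 1) ∧ ((∀ i ∈ Iᶜ, 0 < -x i) ∧ ∑ i ∈ Iᶜ, -x i < 1)}

section

variable {ι : Type*} [Fintype ι] [DecidableEq ι]

lemma orthantPiece_subset (I : Finset ι) : orthantPiece I ⊆ differenceBody ι := by
  rintro x ⟨⟨h1, h2⟩, h3, h4⟩
  constructor
  · rw [← Finset.sum_add_sum_compl I, Finset.sum_congr rfl fun i hi => max_eq_left (h1 i hi).le,
      Finset.sum_eq_zero (s := Iᶜ) fun i hi => max_eq_right (by linarith [h3 i hi]), add_zero]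
    exact h2
  · rw [← Finset.sum_add_sum_compl I,
      Finset.sum_congr (s₁ := Iᶜ) rfl fun i hi => max_eq_left (h3 i hi).le,
      Finset.sum_eq_zero (s := I) fun i hi => max_eq_right (by linarith [h1 i hi]), zero_add]
    exact h4

lemma orthantPiece_eq_preimage (I : Finset ι) : orthantPiece I =
    (MeasurableEquiv.piEquivPiSubtypeProd (fun _ : ι => ℝ) (· ∈ I)) ⁻¹'
      (cornerSimplex {i // i ∈ I} ×ˢ
      ((fun x : {i // i ∉ I} → ℝ => -x) ⁻¹' cornerSimplex {i // i ∉ I})) := by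
  ext x
  have hI : ∀ f : ι → ℝ, ∑ i ∈ Iᶜ, f i = ∑ i : {i // i ∉ I}, f i := fun f =>
    Finset.sum_subtype _ (by simp) _
  simp [orthantPiece, cornerSimplex, hI, Finset.sum_subtype I (fun i => Iff.rfl),
    MeasurableEquiv.piEquivPiSubtypeProd, Equiv.piEquivPiSubtypeProd]

lemma measurableSet_cornerSimplex (ι : Type*) [Fintype ι] : MeasurableSet (cornerSimplex ι) := by
  refine IsOpen.measurableSet (IsOpen.and ?_ ?_)
  · simp only [Set.ofPred_forall]
    exact isOpen_iInter_of_finite fun i => isOpen_lt continuous_const (continuous_apply i)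
  · exact isOpen_lt (by fun_prop) continuous_const

lemma measurableSet_orthantPiece (I : Finset ι) : MeasurableSet (orthantPiece I) := by
  rw [orthantPiece_eq_preimage]
  exact MeasurableEquiv.measurable _ ((measurableSet_cornerSimplex _).prod
    (measurable_neg (measurableSet_cornerSimplex _)))

lemma pairwise_disjoint_orthantPiece :
    Pairwise (Function.onFun Disjoint (orthantPiece (ι := ι))) := by
  intro I J hIJ
  refine Set.disjoint_left.2 ?_
  rintro x ⟨⟨h1, -⟩, h2, -⟩ ⟨⟨h3, -⟩, h4, -⟩
  refine hIJ (Finset.ext fun i => ⟨fun hi => ?_, fun hi => ?_⟩)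
  · by_contra hj
    linarith [h1 i hi, h4 i (Finset.mem_compl.2 hj)]
  · by_contra hj
    linarith [h3 i hi, h2 i (Finset.mem_compl.2 hj)]

/-- Up to a reflection, the piece is a product of corner simplices of dimensions |I| and n - |I|. -/
lemma le_volume_orthantPiece (I : Finset ι) :
    ENNReal.ofReal (1 / (I.card.factorial * (Fintype.card ι - I.card).factorial)) ≤
      volume (orthantPiece I) := by
  have hneg : volume ((fun x : {i // i ∉ I} → ℝ => -x) ⁻¹' cornerSimplex {i // i ∉ I}) =
      volume (cornerSimplex {i // i ∉ I}) := by
    exact Measure.measure_preimage_neg volume _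
  rw [orthantPiece_eq_preimage,
    (volume_preserving_piEquivPiSubtypeProd (fun _ : ι => ℝ) (· ∈ I)).measure_preimage_equiv,
    Measure.volume_eq_prod, Measure.prod_prod, hneg, one_div, mul_inv, ← one_div, ← one_div,
    ENNReal.ofReal_mul (by positivity)]
  refine mul_le_mul' ?_ ?_
  · have h := le_volume_cornerSimplex {i // i ∈ I}
    rw [Fintype.card_coe] at h
    exact h.trans_eq (by congr!)
  · refine le_trans (le_of_eq ?_) (le_volume_cornerSimplex _)
    rw [Fintype.card_of_subtype Iᶜ fun _ => Finset.mem_compl, Finset.card_compl]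

end

/-- Grouping by m = |I| turns the sum into ∑ binom(n, m)² / n!, which Vandermonde's identity
evaluates. -/
lemma sum_one_div_factorial_mul_factorial (n : ℕ) :
    ∑ I : Finset (Fin n), (1 / (I.card.factorial * (n - I.card).factorial) : ℝ) =
      (2 * n).choose n / n.factorial := by
  have h : ∑ I : Finset (Fin n), (1 / (I.card.factorial * (n - I.card).factorial) : ℝ) =
      ∑ I ∈ (Finset.univ : Finset (Fin n)).powerset,
        (fun m : ℕ => (1 / (m.factorial * (n - m).factorial) : ℝ)) I.card := by
    rw [Finset.powerset_univ]
  rw [h, Finset.sum_powerset_apply_card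
    (fun m : ℕ => (1 / (m.factorial * (n - m).factorial) : ℝ)), Finset.card_univ, Fintype.card_fin,
    ← Nat.sum_range_choose_sq, Nat.cast_sum, Finset.sum_div]
  refine Finset.sum_congr rfl fun m hm => ?_
  have hm' : m ≤ n := by simpa [Nat.lt_succ_iff] using hm
  rw [nsmul_eq_mul, ← Nat.choose_mul_factorial_mul_factorial hm']
  have : (0 : ℝ) < n.choose m := by exact_mod_cast Nat.choose_pos hm'
  push_cast
  field_simp

lemma le_volume_differenceBody (n : ℕ) :
    ENNReal.ofReal ((2 * n).choose n / n.factorial) ≤ volume (differenceBody (Fin n)) := by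
  rw [← sum_one_div_factorial_mul_factorial,
    ENNReal.ofReal_sum_of_nonneg fun I _ => by positivity]
  calc _ ≤ ∑ I : Finset (Fin n), volume (orthantPiece I) :=
        Finset.sum_le_sum fun I _ => by simpa using le_volume_orthantPiece I
    _ = volume (⋃ I : Finset (Fin n), orthantPiece I) := by
        rw [measure_iUnion pairwise_disjoint_orthantPiece
          fun I => measurableSet_orthantPiece I, tsum_fintype]
    _ ≤ _ := measure_mono (Set.iUnion_subset fun I => orthantPiece_subset I)

lemma convex_differenceBody (ι : Type*) [Fintype ι] : Convex ℝ (differenceBody ι) := by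
  have hf : ∀ f : (ι → ℝ) →ₗ[ℝ] (ι → ℝ),
      ConvexOn ℝ Set.univ (fun x : ι → ℝ => ∑ i, max (f x i) 0) := by
    intro f
    refine ⟨convex_univ, fun x _ y _ a b ha hb hab => ?_⟩
    simp only [map_add, map_smul, Pi.add_apply, Pi.smul_apply, smul_eq_mul]
    rw [Finset.mul_sum, Finset.mul_sum, ← Finset.sum_add_distrib]
    refine Finset.sum_le_sum fun i _ => max_le ?_ ?_
    · gcongr <;> exact le_max_left _ _
    · positivity
  have h1 := (hf LinearMap.id).convex_lt 1
  have h2 := (hf (-LinearMap.id)).convex_lt 1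
  simpa [differenceBody, Set.ofPred_and] using h1.inter h2

lemma neg_mem_differenceBody {ι : Type*} [Fintype ι] {x : ι → ℝ} (hx : x ∈ differenceBody ι) :
    -x ∈ differenceBody ι := by
  refine ⟨hx.2, ?_⟩
  simpa using hx.1

/-! ### Lattice points in the difference body and the upper bound -/

lemma quadValue_add {d : ℕ} {Q : Matrix (Fin d) (Fin d) ℝ} (hQ : Q.PosDef)
    (x y : Fin d → ℝ) : quadValue Q (x + y) =
      quadValue Q x + 2 * (x ⬝ᵥ Q.mulVec y) + quadValue Q y := by
  have hs : y ⬝ᵥ Q.mulVec x = x ⬝ᵥ Q.mulVec y := by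
    have hT : Q.transpose = Q := by simpa using hQ.isHermitian.eq
    rw [Matrix.dotProduct_mulVec, ← Matrix.mulVec_transpose, hT, dotProduct_comm]
  simp only [quadValue, Matrix.mulVec_add, dotProduct_add, add_dotProduct, hs]
  ring

/-- A nonzero lattice vector is never a difference of two points of a Delone simplex having
positive barycentric coordinate at the vertex `v 0`. -/
lemma IsDeloneSimplex.eq_zero_of_sub_eq {d : ℕ} {Q : Matrix (Fin d) (Fin d) ℝ} (hQ : Q.PosDef)
    {v : Fin (d + 1) → Fin d → ℤ} (hv : IsDeloneSimplex Q v) {z : Fin d → ℤ}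
    {p q : Fin (d + 1) → ℝ} (hp : ∀ i, 0 ≤ p i) (hq : ∀ i, 0 ≤ q i) (hp0 : 0 < p 0)
    (hq0 : 0 < q 0) (hp1 : ∑ i, p i = 1) (hq1 : ∑ i, q i = 1)
    (hz : toReal z = ∑ i, p i • toReal (v i) - ∑ i, q i • toReal (v i)) : z = 0 := by
  obtain ⟨hind, c, r, -, hf⟩ := hv
  set w := Q.mulVec (toReal z) with hw
  have hvi : ∀ i, quadValue Q (toReal (v i) - c) = r ^ 2 := fun i => (hf (v i)).2.2 ⟨i, rfl⟩
  have hadd : ∀ i, quadValue Q (toReal (v i + z) - c) =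
      r ^ 2 + 2 * ((toReal (v i) - c) ⬝ᵥ w) + quadValue Q (toReal z) := by
    intro i
    rw [← hvi i, hw, ← quadValue_add hQ]
    congr 1; ext j; simp [toReal]; ring
  have hsub : ∀ i, quadValue Q (toReal (v i - z) - c) =
      r ^ 2 - 2 * ((toReal (v i) - c) ⬝ᵥ w) + quadValue Q (toReal z) := by
    intro i
    have e : toReal (v i - z) - c = (toReal (v i) - c) + -toReal z := by
      ext j; simp [toReal]; ring
    rw [← hvi i, hw, e, quadValue_add hQ]
    simp [quadValue, Matrix.mulVec_neg]; ring
  have key : ∀ t : Fin (d + 1) → ℝ, ∑ i, t i = 1 →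
      ∑ i, t i * ((toReal (v i) - c) ⬝ᵥ w) = (∑ i, t i • toReal (v i)) ⬝ᵥ w - c ⬝ᵥ w := by
    intro t ht
    simp only [sub_dotProduct, sum_dotProduct, smul_dotProduct, smul_eq_mul, mul_sub,
      Finset.sum_sub_distrib, ← Finset.sum_mul, ht, one_mul]
  have hqz : (∑ i, p i • toReal (v i)) ⬝ᵥ w - (∑ i, q i • toReal (v i)) ⬝ᵥ w =
      quadValue Q (toReal z) := by
    rw [← sub_dotProduct, ← hz]; rfl
  -- Emptiness of the ellipsoid makes all `a i` and `b i` nonnegative. In their averages with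
  -- weights `p` and `q`, the linear terms add up to -2 Q[z], because `z` is the difference of the
  -- two barycentres, and this cancels the two copies of Q[z]. So every weighted term vanishes.
  set a : Fin (d + 1) → ℝ := fun i => quadValue Q (toReal (v i - z) - c) - r ^ 2 with ha
  set b : Fin (d + 1) → ℝ := fun i => quadValue Q (toReal (v i + z) - c) - r ^ 2 with hb
  have ha0 : ∀ i, 0 ≤ p i * a i := fun i => mul_nonneg (hp i) (sub_nonneg.2 (hf _).1)
  have hb0 : ∀ i, 0 ≤ q i * b i := fun i => mul_nonneg (hq i) (sub_nonneg.2 (hf _).1)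
  have hsum : ∑ i, p i * a i + ∑ i, q i * b i = 0 := by
    have e1 : ∑ i, p i * a i =
        quadValue Q (toReal z) - 2 * ∑ i, p i * ((toReal (v i) - c) ⬝ᵥ w) := by
      rw [← one_mul (quadValue Q (toReal z)), ← hp1, Finset.sum_mul, Finset.mul_sum,
        ← Finset.sum_sub_distrib]
      refine Finset.sum_congr rfl fun i _ => ?_
      simp only [ha, hsub]; ring
    have e2 : ∑ i, q i * b i =
        quadValue Q (toReal z) + 2 * ∑ i, q i * ((toReal (v i) - c) ⬝ᵥ w) := by
      rw [← one_mul (quadValue Q (toReal z)), ← hq1, Finset.sum_mul, Finset.mul_sum,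
        ← Finset.sum_add_distrib]
      refine Finset.sum_congr rfl fun i _ => ?_
      simp only [hb, hadd]; ring
    rw [e1, e2, key p hp1, key q hq1]
    linarith
  have hpa : ∑ i, p i * a i = 0 := by
    linarith [Finset.sum_nonneg fun i (_ : i ∈ Finset.univ) => ha0 i,
      Finset.sum_nonneg fun i (_ : i ∈ Finset.univ) => hb0 i]
  have hqb : ∑ i, q i * b i = 0 := by linarith
  have ha1 : p 0 * a 0 = 0 :=
    (Finset.sum_eq_zero_iff_of_nonneg fun i _ => ha0 i).1 hpa 0 (Finset.mem_univ _)
  have hb1 : q 0 * b 0 = 0 :=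
    (Finset.sum_eq_zero_iff_of_nonneg fun i _ => hb0 i).1 hqb 0 (Finset.mem_univ _)
  obtain ⟨i, hi⟩ := (hf _).2.1 (sub_eq_zero.1 ((mul_eq_zero.1 ha1).resolve_left hp0.ne'))
  obtain ⟨j, hj⟩ := (hf _).2.1 (sub_eq_zero.1 ((mul_eq_zero.1 hb1).resolve_left hq0.ne'))
  -- Both `v 0 - z` and `v 0 + z` are vertices, so `v 0` is their midpoint; for `z ≠ 0` this is a
  -- nontrivial affine relation.
  have hmid : v i + v j = v 0 + v 0 := by rw [← hi, ← hj]; abel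
  by_contra hz0
  have hi0 : i ≠ 0 := by rintro rfl; exact hz0 (by simpa using hi)
  have hj0 : j ≠ 0 := by rintro rfl; exact hz0 (by simpa using hj)
  rw [affineIndependent_iff_of_fintype] at hind
  let t : Fin (d + 1) → ℝ := fun l =>
    (if l = i then 1 else 0) + (if l = j then 1 else 0) - (if l = 0 then 2 else 0)
  have ht : ∑ l, t l = 0 := by
    simp only [t, Finset.sum_sub_distrib, Finset.sum_add_distrib, Finset.sum_ite_eq',
      Finset.mem_univ, if_true]
    norm_num
  have h := hind t ht (by
    rw [Finset.weightedVSub_eq_linear_combination Finset.univ ht]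
    simp only [t, sub_smul, add_smul, ite_smul, one_smul, zero_smul, Finset.sum_sub_distrib,
      Finset.sum_add_distrib, Finset.sum_ite_eq', Finset.mem_univ, if_true]
    ext l
    have hl : (v i l : ℝ) + v j l = v 0 l + v 0 l := by exact_mod_cast congrFun hmid l
    simp only [toReal, Pi.sub_apply, Pi.add_apply, Pi.smul_apply, smul_eq_mul, Pi.zero_apply]
    linarith) 0
  simp [t, hi0.symm, hj0.symm] at h

/-- The point with barycentric coordinates `x`, the rest of the mass being at the vertex `v 0`. -/
lemma sum_cons_smul {d : ℕ} (v : Fin (d + 1) → Fin d → ℤ) (x : Fin d → ℝ) :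
    ∑ i, (Fin.cons (1 - ∑ i, x i) x : Fin (d + 1) → ℝ) i • toReal (v i) =
      toReal (v 0) + (realEdgeMatrix v).transpose.mulVec x := by
  ext j
  simp only [Fin.sum_univ_succ, Fin.cons_zero, Fin.cons_succ, Pi.add_apply, Pi.smul_apply,
    Finset.sum_apply, smul_eq_mul, Matrix.mulVec, dotProduct, Matrix.transpose_apply,
    realEdgeMatrix_apply, toReal, sub_mul, Finset.sum_mul, one_mul, Finset.sum_sub_distrib]
  simp only [mul_comm]
  ring

/-- Split `u` into positive and negative parts as barycentric weights of two points. The strict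
inequalities in `differenceBody` leave positive weight for the vertex `v 0` in both. -/
lemma IsDeloneSimplex.eq_zero_of_mem_image {d : ℕ} {Q : Matrix (Fin d) (Fin d) ℝ} (hQ : Q.PosDef)
    {v : Fin (d + 1) → Fin d → ℤ} (hv : IsDeloneSimplex Q v) {z : Fin d → ℤ}
    (hz : toReal z ∈ Matrix.toLin' (realEdgeMatrix v).transpose '' differenceBody (Fin d)) :
    z = 0 := by
  obtain ⟨u, ⟨h1, h2⟩, hu⟩ := hz
  refine hv.eq_zero_of_sub_eq hQ
    (p := Fin.cons (1 - ∑ i, max (u i) 0) fun i => max (u i) 0)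
    (q := Fin.cons (1 - ∑ i, max (-u i) 0) fun i => max (-u i) 0) ?_ ?_ ?_ ?_ ?_ ?_ ?_
  · refine Fin.cases ?_ fun i => ?_
    · simpa using h1.le
    · simp
  · refine Fin.cases ?_ fun i => ?_
    · simpa using h2.le
    · simp
  · simpa using h1
  · simpa using h2
  · simp [Fin.sum_univ_succ]
  · simp [Fin.sum_univ_succ]
  · rw [sum_cons_smul, sum_cons_smul, ← hu, Matrix.toLin'_apply, add_sub_add_left_eq_sub,
      ← Matrix.mulVec_sub]
    congr 1
    ext i
    simp only [Pi.sub_apply]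
    rcases le_total 0 (u i) with h | h <;> simp [h]

/-- Minkowski's theorem for `ℤ^d`. -/
lemma volume_le_of_forall_int_eq_zero {d : ℕ} {s : Set (Fin d → ℝ)} (hsymm : ∀ x ∈ s, -x ∈ s)
    (hconv : Convex ℝ s) (hs : ∀ z : Fin d → ℤ, toReal z ∈ s → z = 0) :
    volume s ≤ 2 ^ d := by
  by_contra! h
  set b := Pi.basisFun ℝ (Fin d) with hb
  have hvol : volume (ZSpan.fundamentalDomain b) = 1 := by
    rw [ZSpan.volume_fundamentalDomain]
    have : (Matrix.of ⇑b) = 1 := by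
      ext i j; simp [hb, Matrix.one_apply, Pi.single_apply, eq_comm]
    rw [this]; simp
  have hfund := ZSpan.isAddFundamentalDomain b volume
  have : Countable (Submodule.span ℤ (Set.range b)).toAddSubgroup :=
    inferInstanceAs (Countable (Submodule.span ℤ (Set.range b)))
  obtain ⟨x, hx0, hx⟩ := exists_ne_zero_mem_lattice_of_measure_mul_two_pow_lt_measure
    (L := (Submodule.span ℤ (Set.range b)).toAddSubgroup) hfund hsymm hconv
    (by rw [hvol]; simpa using h)
  have hmem : (x : Fin d → ℝ) ∈ Submodule.span ℤ (Set.range b) := x.2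
  rw [b.mem_span_iff_repr_mem ℤ] at hmem
  choose z hz using hmem
  have hxz : (x : Fin d → ℝ) = toReal z := by
    ext i
    have := hz i
    simp [hb] at this
    simp [toReal, this]
  have h0 := hs z (hxz ▸ hx)
  apply hx0
  ext i
  rw [hxz, h0]
  simp [toReal]

/-- The volume bound for Delone simplices. -/
theorem relVolume_le {d : ℕ} {Q : Matrix (Fin d) (Fin d) ℝ} (hQ : Q.PosDef)
    {v : Fin (d + 1) → Fin d → ℤ} (hv : IsDeloneSimplex Q v) :
    relVolume v ≤ 2 ^ d * (d.factorial : ℝ) / ((2 * d).choose d : ℝ) := by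
  have h := volume_le_of_forall_int_eq_zero
    (s := Matrix.toLin' (realEdgeMatrix v).transpose '' differenceBody (Fin d))
    (by
      rintro _ ⟨x, hx, rfl⟩
      exact ⟨-x, neg_mem_differenceBody hx, map_neg _ _⟩)
    ((convex_differenceBody _).linear_image _) (fun z hz => hv.eq_zero_of_mem_image hQ hz)
  rw [Measure.addHaar_image_linearMap, LinearMap.det_toLin', Matrix.det_transpose,
    det_realEdgeMatrix, ← relVolume_eq_abs_det] at h
  have hnn : 0 ≤ relVolume v := by rw [relVolume_eq_abs_det]; positivity
  have h2 := (mul_le_mul_right (le_volume_differenceBody d) (ENNReal.ofReal (relVolume v))).trans h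
  rw [← ENNReal.ofReal_mul hnn, ← ENNReal.ofReal_ofNat, ← ENNReal.ofReal_pow (by norm_num),
    ENNReal.ofReal_le_ofReal_iff (by positivity)] at h2
  have hc : (0 : ℝ) < (2 * d).choose d := by exact_mod_cast Nat.choose_pos (by omega)
  rw [le_div_iff₀ hc]
  have hf : (0 : ℝ) < d.factorial := by positivity
  rwa [← mul_div_assoc, div_le_iff₀ hf] at h2

/-! ### Pyramids and monotonicity in the dimension -/

/-- The matrix of `(t, x) ↦ x + t • u`. -/
def shearMatrix {d : ℕ} (u : Fin d → ℝ) : Matrix (Fin d) (Fin (d + 1)) ℝ :=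
  Matrix.of fun i => Fin.cons (u i) (Pi.single i 1)

lemma shearMatrix_mulVec {d : ℕ} (u : Fin d → ℝ) (y : Fin (d + 1) → ℝ) :
    (shearMatrix u).mulVec y = Fin.tail y + y 0 • u := by
  ext i
  simp [shearMatrix, Matrix.mulVec, dotProduct, Fin.sum_univ_succ, Fin.tail, Pi.single_apply]
  ring

/-- The form `(t, x) ↦ Q[x + t • u] + s * t ^ 2`. -/
def pyramidForm {d : ℕ} (Q : Matrix (Fin d) (Fin d) ℝ) (u : Fin d → ℝ) (s : ℝ) :
    Matrix (Fin (d + 1)) (Fin (d + 1)) ℝ :=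
  (shearMatrix u).transpose * Q * shearMatrix u + Matrix.diagonal (Pi.single 0 s)

lemma quadValue_pyramidForm {d : ℕ} (Q : Matrix (Fin d) (Fin d) ℝ) (u : Fin d → ℝ) (s : ℝ)
    (y : Fin (d + 1) → ℝ) :
    quadValue (pyramidForm Q u s) y = quadValue Q (Fin.tail y + y 0 • u) + s * y 0 ^ 2 := by
  rw [← shearMatrix_mulVec]
  simp only [quadValue, pyramidForm, Matrix.add_mulVec, dotProduct_add]
  congr 1
  · rw [← Matrix.mulVec_mulVec, ← Matrix.mulVec_mulVec, Matrix.dotProduct_mulVec y,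
      Matrix.vecMul_transpose]
  · simp only [dotProduct, Matrix.mulVec_diagonal, Fin.sum_univ_succ]
    simp
    ring

lemma quadValue_pos {d : ℕ} {Q : Matrix (Fin d) (Fin d) ℝ} (hQ : Q.PosDef) {x : Fin d → ℝ}
    (hx : x ≠ 0) : 0 < quadValue Q x := by
  simpa [quadValue] using hQ.dotProduct_mulVec_pos hx

lemma quadValue_nonneg {d : ℕ} {Q : Matrix (Fin d) (Fin d) ℝ} (hQ : Q.PosDef) (x : Fin d → ℝ) :
    0 ≤ quadValue Q x := by
  rcases eq_or_ne x 0 with rfl | hx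
  · simp [quadValue]
  · exact (quadValue_pos hQ hx).le

lemma posDef_pyramidForm {d : ℕ} {Q : Matrix (Fin d) (Fin d) ℝ} (hQ : Q.PosDef) (u : Fin d → ℝ)
    {s : ℝ} (hs : 0 < s) : (pyramidForm Q u s).PosDef := by
  refine Matrix.PosDef.of_dotProduct_mulVec_pos ?_ fun y hy => ?_
  · have hT : Q.transpose = Q := by simpa using hQ.isHermitian.eq
    simp [Matrix.IsHermitian, pyramidForm, Matrix.transpose_mul, hT, Matrix.mul_assoc]
  · have h := quadValue_pyramidForm Q u s y
    rw [star_trivial]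
    change 0 < quadValue _ y
    rw [h]
    rcases eq_or_ne (y 0) 0 with h0 | h0
    · have ht : Fin.tail y ≠ 0 := by
        intro ht
        refine hy (funext fun i => Fin.cases h0 (fun j => congrFun ht j) i)
      simpa [h0] using quadValue_pos hQ ht
    · have := quadValue_nonneg hQ (Fin.tail y + y 0 • u)
      positivity

/-- The pyramid over a lattice simplex, with apex at height one over the vertex `v 0`. -/
def pyramid {d : ℕ} (v : Fin (d + 1) → Fin d → ℤ) : Fin (d + 2) → Fin (d + 1) → ℤ :=
  Fin.cons (Fin.cons 0 (v 0)) (Fin.cons (Fin.cons 1 (v 0)) fun i => Fin.cons 0 (v i.succ))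

lemma exists_eq_pyramid_iff {d : ℕ} (v : Fin (d + 1) → Fin d → ℤ) (t : ℤ) (x : Fin d → ℤ) :
    (∃ i, (Fin.cons t x : Fin (d + 1) → ℤ) = pyramid v i) ↔
      (t = 0 ∧ ∃ i, x = v i) ∨ (t = 1 ∧ x = v 0) := by
  simp only [pyramid, Fin.exists_fin_succ, Fin.cons_zero, Fin.cons_succ, Fin.cons_inj]
  tauto

/-- With the apex listed right after `v 0`, the first edge is the unit vector of the new coordinate;
expand along that row. -/
lemma det_edgeMatrix_pyramid {d : ℕ} (v : Fin (d + 1) → Fin d → ℤ) :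
    (edgeMatrix (pyramid v)).det = (edgeMatrix v).det := by
  rw [Matrix.det_succ_row_zero, Fin.sum_univ_succ, Finset.sum_eq_zero, add_zero]
  · have h : (edgeMatrix (pyramid v)).submatrix Fin.succ (Fin.succAbove 0) = edgeMatrix v := by
      ext i j
      simp [edgeMatrix, pyramid]
    rw [h]
    simp [edgeMatrix, pyramid]
  · intro j _
    simp [edgeMatrix, pyramid]

/-- The shear by `u` moves the centre of the layer t = 1 to `v 0`, so there only the apex can be on
the ellipsoid. With centre height h and coefficient s of t², the layers 0 and 1 touch the same
ellipsoid when r² + s h² = s (1 - h)²; h = 1/4 and s = 2r² solve this, with squared radius 9/8 r².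
Since 0 < h < 1/2, all other layers lie outside. -/
lemma isDeloneSimplex_pyramid {d : ℕ} {Q : Matrix (Fin d) (Fin d) ℝ} (hQ : Q.PosDef)
    {v : Fin (d + 1) → Fin d → ℤ} (hv : IsDeloneSimplex Q v) :
    ∃ Q' : Matrix (Fin (d + 1)) (Fin (d + 1)) ℝ, Q'.PosDef ∧ IsDeloneSimplex Q' (pyramid v) := by
  obtain ⟨hind, c, r, hr, hf⟩ := hv
  set u : Fin d → ℝ := c - toReal (v 0) with hu
  refine ⟨pyramidForm Q u (2 * r ^ 2), posDef_pyramidForm hQ u (by positivity), ?_,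
    Fin.cons (1 / 4) (c - (1 / 4 : ℝ) • u), Real.sqrt (9 / 8) * r, by positivity, ?_⟩
  · rw [affineIndependent_iff_det_edgeMatrix_ne_zero] at hind ⊢
    rwa [det_edgeMatrix_pyramid]
  · intro y
    obtain ⟨t, x, rfl⟩ : ∃ t x, y = Fin.cons t x := ⟨y 0, Fin.tail y, (Fin.cons_self_tail y).symm⟩
    rw [mul_pow, Real.sq_sqrt (by norm_num), quadValue_pyramidForm, exists_eq_pyramid_iff]
    have e0 : (toReal (Fin.cons t x : Fin (d + 1) → ℤ) -
        (Fin.cons (1 / 4) (c - (1 / 4 : ℝ) • u) : Fin (d + 1) → ℝ)) 0 = (t : ℝ) - 1 / 4 := by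
      simp [toReal]
    have e1 : Fin.tail (toReal (Fin.cons t x : Fin (d + 1) → ℤ) -
        (Fin.cons (1 / 4) (c - (1 / 4 : ℝ) • u) : Fin (d + 1) → ℝ)) + ((t : ℝ) - 1 / 4) • u =
        toReal x + (t : ℝ) • u - c := by
      ext i
      simp [Fin.tail, toReal]
      ring
    rw [e0, e1]
    have hr2 : 0 < r ^ 2 := by positivity
    rcases eq_or_ne t 0 with rfl | h0
    · obtain ⟨h1, h2⟩ := hf x
      simp only [Int.cast_zero, zero_smul, add_zero, true_and, zero_ne_one, false_and, or_false]
      rw [← h2]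
      constructor
      · linarith
      · constructor <;> intro h <;> linarith
    rcases eq_or_ne t 1 with rfl | h1
    · have e : toReal x + ((1 : ℤ) : ℝ) • u - c = toReal (x - v 0) := by
        ext i
        simp [hu, toReal]
        ring
      rw [e]
      simp only [Int.cast_one, one_ne_zero, false_and, true_and, false_or]
      have hnn := quadValue_nonneg hQ (toReal (x - v 0))
      refine ⟨by linarith, fun h => ?_, ?_⟩
      · by_contra hx
        have hne : toReal (x - v 0) ≠ 0 := by
          intro h'
          refine hx (funext fun i => ?_)
          have := congrFun h' i
          simp only [toReal, Pi.sub_apply, Pi.zero_apply, Int.cast_eq_zero] at this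
          linarith
        have := quadValue_pos hQ hne
        linarith
      · rintro rfl
        have : toReal (v 0 - v 0) = 0 := by ext i; simp [toReal]
        rw [this]
        simp [quadValue]
        ring
    · have hnn := quadValue_nonneg hQ (toReal x + (t : ℝ) • u - c)
      have ht : 9 / 16 < ((t : ℝ) - 1 / 4) ^ 2 := by
        rcases lt_or_ge t 0 with h | h
        · have : (t : ℝ) ≤ -1 := by exact_mod_cast (by omega : t ≤ -1)
          nlinarith
        · have : (2 : ℝ) ≤ t := by exact_mod_cast (by omega : 2 ≤ t)
          nlinarith
      have hlt : 9 / 8 * r ^ 2 < quadValue Q (toReal x + (t : ℝ) • u - c) +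
          2 * r ^ 2 * ((t : ℝ) - 1 / 4) ^ 2 := by
        nlinarith [mul_lt_mul_of_pos_left ht hr2]
      refine ⟨hlt.le, fun h => absurd h hlt.ne', ?_⟩
      rintro (⟨h, -⟩ | ⟨h, -⟩)
      · exact absurd h h0
      · exact absurd h h1

/-- Every relative volume of a Delone simplex occurs in all higher dimensions. -/
theorem relVolumes_mono : Monotone relVolumes := by
  refine monotone_nat_of_le_succ fun d => ?_
  rintro _ ⟨Q, hQ, v, hv, rfl⟩
  obtain ⟨Q', hQ', hv'⟩ := isDeloneSimplex_pyramid hQ hv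
  exact ⟨Q', hQ', pyramid v, hv', by
    rw [relVolume_eq_abs_det, relVolume_eq_abs_det, det_edgeMatrix_pyramid]⟩

/-! ### The simplex code and its determinant -/

open Matrix

/-- The coordinates of the simplex code of dimension `k`. -/
abbrev CodeIndex (k : ℕ) : Type := {b : Fin k → ZMod 2 // b ≠ 0}

lemma card_codeIndex (k : ℕ) : Fintype.card (CodeIndex k) = 2 ^ k - 1 := by
  rw [Fintype.card_subtype_compl, Fintype.card_subtype_eq]
  simp

/-- The codewords of the simplex code, as `0/1` vectors. -/
def codeword {k : ℕ} (a : Fin k → ZMod 2) : CodeIndex k → ℤ := fun b => ((a ⬝ᵥ b.1).val : ℤ)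

/-- The lattice of integer vectors that reduce to codewords modulo two. -/
def codeLattice (k : ℕ) : Submodule ℤ (CodeIndex k → ℤ) where
  carrier := {x | ∃ a : Fin k → ZMod 2, ∀ b : CodeIndex k, (x b : ZMod 2) = a ⬝ᵥ b.1}
  zero_mem' := ⟨0, fun b => by simp⟩
  add_mem' := by
    rintro x y ⟨a, ha⟩ ⟨a', ha'⟩
    exact ⟨a + a', fun b => by simp [ha, ha', add_dotProduct]⟩
  smul_mem' := by
    rintro n x ⟨a, ha⟩
    exact ⟨(n : ZMod 2) • a, fun b => by simp [ha, smul_dotProduct]⟩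

lemma codeword_mem {k : ℕ} (a : Fin k → ZMod 2) : codeword a ∈ codeLattice k :=
  ⟨a, fun b => by simp [codeword]⟩

lemma two_smul_mem_codeLattice {k : ℕ} (x : CodeIndex k → ℤ) : (2 : ℤ) • x ∈ codeLattice k := by
  refine ⟨0, fun b => ?_⟩
  have : (2 : ZMod 2) = 0 := rfl
  simp [this]

/-- The lattice lies between 2ℤ^n and ℤ^n. -/
lemma finrank_codeLattice (k : ℕ) :
    Module.finrank ℤ (codeLattice k) = Fintype.card (CodeIndex k) := by
  refine le_antisymm ?_ ?_
  · simpa using Submodule.finrank_le (codeLattice k)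
  · have h : Function.Injective
        (((2 : ℤ) • LinearMap.id : (CodeIndex k → ℤ) →ₗ[ℤ] (CodeIndex k → ℤ)).codRestrict
          (codeLattice k) fun x => two_smul_mem_codeLattice x) := by
      intro x y hxy
      have h2 : (2 : ℤ) • x = (2 : ℤ) • y := congrArg Subtype.val hxy
      exact smul_right_injective _ (two_ne_zero) h2
    simpa using LinearMap.finrank_le_finrank_of_injective h

/-- A vector of the code lattice with entries `0` and `1` is a codeword. -/
lemma exists_eq_codeword {k : ℕ} {x : CodeIndex k → ℤ} (hx : x ∈ codeLattice k)
    (h : ∀ b, x b = 0 ∨ x b = 1) : ∃ a, x = codeword a := by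
  obtain ⟨a, ha⟩ := hx
  refine ⟨a, funext fun b => ?_⟩
  rw [codeword, ← ha b]
  rcases h b with h | h <;> rw [h] <;> rfl

lemma codeword_eq_zero_or_one {k : ℕ} (a : Fin k → ZMod 2) (b : CodeIndex k) :
    codeword a b = 0 ∨ codeword a b = 1 := by
  have := ZMod.val_lt (a ⬝ᵥ b.1)
  simp only [codeword]
  omega

lemma codeword_zero {k : ℕ} : codeword (0 : Fin k → ZMod 2) = 0 := by
  ext b; simp [codeword]

/-- The nontrivial character of `ZMod 2`. -/
def sgn (s : ZMod 2) : ℤ := 1 - 2 * s.val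

lemma sgn_add (s t : ZMod 2) : sgn (s + t) = sgn s * sgn t := by
  revert s t; decide

lemma sum_sgn_dotProduct {k : ℕ} (a : Fin k → ZMod 2) :
    ∑ b : Fin k → ZMod 2, sgn (a ⬝ᵥ b) = if a = 0 then 2 ^ k else 0 := by
  split_ifs with h
  · subst h
    simp [sgn]
  · obtain ⟨i, hi⟩ := Function.ne_iff.1 h
    have hi1 : a i = 1 := by
      have : ∀ s : ZMod 2, s ≠ 0 → s = 1 := by decide
      exact this _ hi
    have hs : ∑ b : Fin k → ZMod 2, sgn (a ⬝ᵥ b) =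
        ∑ b : Fin k → ZMod 2, -sgn (a ⬝ᵥ b) := by
      -- Shifting `b` by the `i`-th unit vector, where `a i = 1`, flips every sign.
      rw [← Equiv.sum_comp (Equiv.addRight (Pi.single i (1 : ZMod 2)))]
      refine Finset.sum_congr rfl fun b _ => ?_
      rw [Equiv.coe_addRight, dotProduct_add, sgn_add, dotProduct_single, hi1, one_mul,
        show sgn 1 = -1 by decide, mul_neg_one]
    rw [Finset.sum_neg_distrib] at hs
    omega

/-- The matrix of nonzero codewords of the simplex code. -/
def codeMatrix (k : ℕ) : Matrix (CodeIndex k) (CodeIndex k) ℤ := of fun a b => codeword a.1 b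

/-- Entries are (1 - `sgn`) / 2. The index b = 0 contributes nothing, so the sum extends to the
whole group, where character orthogonality leaves 2^k, and another 2^k when a = c. -/
lemma four_smul_codeMatrix_sq (k : ℕ) : (4 : ℤ) • (codeMatrix k * codeMatrix k) =
    (2 ^ k : ℤ) • (1 + replicateCol Unit (fun _ => (1 : ℤ)) * replicateRow Unit fun _ => (1 : ℤ)) := by
  ext a c
  have hc : ∀ b : Fin k → ZMod 2, c.1 ⬝ᵥ b = b ⬝ᵥ c.1 := fun b => dotProduct_comm _ _
  have hsum : 4 * ∑ b : CodeIndex k, codeword a.1 b * codeword b.1 c =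
      ∑ b : Fin k → ZMod 2, (1 - sgn (a.1 ⬝ᵥ b)) * (1 - sgn (c.1 ⬝ᵥ b)) := by
    rw [← Fintype.sum_subtype_add_sum_subtype (fun b : Fin k → ZMod 2 => b ≠ 0),
      Finset.mul_sum]
    have hz : ∑ b : {b : Fin k → ZMod 2 // ¬ b ≠ 0},
        (1 - sgn (a.1 ⬝ᵥ b.1)) * (1 - sgn (c.1 ⬝ᵥ b.1)) = 0 := by
      refine Finset.sum_eq_zero fun b _ => ?_
      rw [not_not.1 b.2]
      simp [sgn]
    rw [hz, add_zero]
    refine Finset.sum_congr rfl fun b _ => ?_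
    simp only [codeword, sgn, hc]
    ring
  have hexp : ∀ b : Fin k → ZMod 2, (1 - sgn (a.1 ⬝ᵥ b)) * (1 - sgn (c.1 ⬝ᵥ b)) =
      1 - sgn (a.1 ⬝ᵥ b) - sgn (c.1 ⬝ᵥ b) + sgn ((a.1 + c.1) ⬝ᵥ b) := by
    intro b
    rw [add_dotProduct, sgn_add]
    ring
  have hac : a.1 + c.1 = 0 ↔ a = c := by
    have hneg : -c.1 = c.1 := funext fun i => ZMod.neg_eq_self_mod_two _
    rw [add_eq_zero_iff_eq_neg, hneg, Subtype.ext_iff]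
  simp only [hexp, Finset.sum_add_distrib, Finset.sum_sub_distrib, sum_sgn_dotProduct,
    if_neg a.2, if_neg c.2, hac] at hsum
  simp only [Matrix.smul_apply, Matrix.mul_apply, codeMatrix, of_apply, smul_eq_mul, hsum,
    Matrix.add_apply, Matrix.one_apply]
  simp only [Finset.sum_const, Finset.card_univ, Fintype.card_fun, ZMod.card, Fintype.card_fin,
    replicateCol_apply, replicateRow_apply]
  split_ifs
  · simp; ring
  · simp

/-- The rank-one update has det(I + J) = 1 + (2^k - 1) = 2^k, which supplies the last factor of the
power. -/
lemma sq_det_codeMatrix (k : ℕ) :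
    (2 ^ (2 ^ k - 1) * (codeMatrix k).det) ^ 2 = ((2 : ℤ) ^ k) ^ (2 ^ k) := by
  have h := congrArg Matrix.det (four_smul_codeMatrix_sq k)
  rw [det_smul, det_smul, det_mul, det_one_add_replicateCol_mul_replicateRow,
    card_codeIndex] at h
  have hk : 1 ≤ 2 ^ k := Nat.one_le_two_pow
  have hd : (1 : ℤ) + (fun _ : CodeIndex k => (1 : ℤ)) ⬝ᵥ (fun _ => 1) = 2 ^ k := by
    simp only [dotProduct, mul_one, Finset.sum_const, Finset.card_univ, card_codeIndex]
    rw [nsmul_eq_mul, Nat.cast_sub hk]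
    push_cast
    ring
  rw [hd, ← pow_succ, Nat.sub_add_cancel hk] at h
  rw [← h, show (4 : ℤ) = 2 ^ 2 by norm_num, ← pow_mul, mul_comm 2, pow_mul]
  ring

/-! ### The codewords as a Delone simplex -/

lemma quadValue_mul_transpose {d : ℕ} (T : Matrix (Fin d) (Fin d) ℝ) (x : Fin d → ℝ) :
    quadValue (T * T.transpose) x = ∑ j, (T.transpose.mulVec x) j ^ 2 := by
  rw [quadValue, ← mulVec_mulVec, dotProduct_mulVec, ← mulVec_transpose]
  simp [dotProduct, sq]

lemma quarter_le_sub_half_sq (n : ℤ) : (1 / 4 : ℝ) ≤ (n - 1 / 2) ^ 2 := by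
  have h : (0 : ℤ) ≤ n * (n - 1) := by
    rcases le_or_gt n 0 with h | h <;> nlinarith
  have h' : (0 : ℝ) ≤ n * (n - 1) := by exact_mod_cast h
  nlinarith

lemma sub_half_sq_eq_iff (n : ℤ) : ((n : ℝ) - 1 / 2) ^ 2 = 1 / 4 ↔ n = 0 ∨ n = 1 := by
  have h : ((n : ℝ) - 1 / 2) ^ 2 = 1 / 4 ↔ (n : ℝ) * (n - 1) = 0 := by
    constructor <;> intro h <;> linarith
  rw [h, mul_eq_zero, sub_eq_zero]
  norm_cast

/-- The sphere around the unit cube makes the codewords a Delone simplex of the code lattice. -/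
theorem exists_large_relVolume {k : ℕ} (hk : 1 ≤ k) : ∃ t ∈ relVolumes (2 ^ k - 1),
    0 ≤ t ∧ ((2 : ℝ) ^ k) ^ (2 ^ k) ≤ (4 ^ (2 ^ k - 1) * t) ^ 2 := by
  obtain ⟨d, hd⟩ : ∃ d, 2 ^ k - 1 = d := ⟨_, rfl⟩
  have hk2 : 2 ≤ 2 ^ k := by
    calc 2 = 2 ^ 1 := rfl
      _ ≤ 2 ^ k := Nat.pow_le_pow_right (by norm_num) hk
  have hd0 : 0 < d := by omega
  have hcard : Fintype.card (CodeIndex k) = d := (card_codeIndex k).trans hd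
  obtain ⟨e⟩ : Nonempty (Fin d ≃ CodeIndex k) := ⟨(Fintype.equivFinOfCardEq hcard).symm⟩
  let B := Module.finBasisOfFinrankEq ℤ (codeLattice k) ((finrank_codeLattice k).trans hcard)
  let T : Matrix (Fin d) (Fin d) ℤ := of fun i j => (B i : CodeIndex k → ℤ) (e j)
  let a : Fin (d + 1) → Fin k → ZMod 2 := Fin.cons 0 fun i => (e i).1
  let v : Fin (d + 1) → Fin d → ℤ := fun i => B.equivFun ⟨codeword (a i), codeword_mem _⟩
  have hT : ∀ (x : codeLattice k) (j : Fin d),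
      ∑ i, B.equivFun x i * T i j = (x : CodeIndex k → ℤ) (e j) := by
    intro x j
    have h := congrFun (congrArg Subtype.val (B.sum_equivFun x)) (e j)
    rw [← h]
    simp only [T, of_apply, Submodule.coe_sum, Submodule.coe_smul, Finset.sum_apply,
      Pi.smul_apply, smul_eq_mul]
  -- `v` lists the codewords in the basis `B`, and `T` turns these coordinates back into vectors.
  have hdetC : (edgeMatrix v).det * T.det = (codeMatrix k).det := by
    rw [← det_mul, ← det_submatrix_equiv_self e (codeMatrix k)]
    congr 1
    ext i j
    rw [mul_apply]
    have h0 : ∀ j, v 0 j = 0 := by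
      intro j
      have : (⟨codeword (a 0), codeword_mem _⟩ : codeLattice k) = 0 := by
        ext1; simp [a, codeword_zero]
      simp only [v, this, map_zero, Pi.zero_apply]
    simp only [edgeMatrix, of_apply, h0, sub_zero, v, hT]
    simp [codeMatrix, a]
  -- As 2ℤ^d lies in the lattice, the index |det T| divides 2^d; this crude bound suffices.
  have hdetT : ∃ s : ℤ, s * T.det = 2 ^ d := by
    let S : Matrix (Fin d) (Fin d) ℤ := of fun i =>
      B.equivFun ⟨(2 : ℤ) • Pi.single (e i) 1, two_smul_mem_codeLattice _⟩
    refine ⟨S.det, ?_⟩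
    have : S * T = (2 : ℤ) • (1 : Matrix (Fin d) (Fin d) ℤ) := by
      ext i j
      rw [mul_apply]
      simp only [S, of_apply, hT]
      simp [Matrix.one_apply, Pi.single_apply, eq_comm]
    rw [← det_mul, this, det_smul, det_one, mul_one, Fintype.card_fin]
  have hsq := sq_det_codeMatrix k
  rw [hd] at hsq
  have hTle : |T.det| ≤ 2 ^ d := by
    obtain ⟨s, hs⟩ := hdetT
    exact Int.le_of_dvd (by positivity) ((abs_dvd _ _).2 ⟨s, by rw [← hs, mul_comm]⟩)
  have hT0 : T.det ≠ 0 := by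
    obtain ⟨s, hs⟩ := hdetT
    intro h
    rw [h, mul_zero] at hs
    exact pow_ne_zero d two_ne_zero hs.symm
  have hv0 : (edgeMatrix v).det ≠ 0 := by
    intro h
    rw [← hdetC, h] at hsq
    have : (0 : ℤ) < ((2 : ℤ) ^ k) ^ (2 ^ k) := by positivity
    rw [← hsq] at this
    simp at this
  have hvol : ((2 : ℝ) ^ k) ^ (2 ^ k) ≤ (4 ^ d * relVolume v) ^ 2 := by
    have h1 : ((2 : ℤ) ^ k) ^ (2 ^ k) ≤ (4 ^ d * |(edgeMatrix v).det|) ^ 2 := by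
      rw [← hsq, ← hdetC, ← sq_abs, abs_mul, abs_mul, abs_of_nonneg (by positivity)]
      refine pow_le_pow_left₀ (by positivity) ?_ 2
      calc (2 : ℤ) ^ d * (|(edgeMatrix v).det| * |T.det|)
          ≤ 2 ^ d * (|(edgeMatrix v).det| * 2 ^ d) := by gcongr
        _ = 4 ^ d * |(edgeMatrix v).det| := by
          rw [show (4 : ℤ) = 2 * 2 by norm_num, mul_pow]; ring
    rw [relVolume_eq_abs_det]
    exact_mod_cast h1
  let R : Matrix (Fin d) (Fin d) ℝ := T.map (Int.castRingHom ℝ)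
  have hR0 : IsUnit R.transpose.det := by
    rw [det_transpose]
    have : R.det = (T.det : ℝ) := by
      simpa [R, RingHom.mapMatrix_apply] using ((Int.castRingHom ℝ).map_det T).symm
    rw [this, isUnit_iff_ne_zero]
    exact_mod_cast hT0
  have hRunit : IsUnit R.transpose := (isUnit_iff_isUnit_det _).2 hR0
  have hpos : (R * R.transpose).PosDef := by
    have := PosDef.conjTranspose_mul_self R.transpose (mulVec_injective_of_isUnit hRunit)
    simpa using this
  have hRv : ∀ (y : Fin d → ℤ) (j : Fin d), (R.transpose.mulVec (toReal y)) j =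
      (((B.equivFun.symm y : codeLattice k) : CodeIndex k → ℤ) (e j) : ℝ) := by
    intro y j
    rw [← hT, LinearEquiv.apply_symm_apply]
    simp [R, mulVec, dotProduct, toReal, mul_comm]
  -- The centre corresponds to (1/2, …, 1/2), so the form measures the distance to the centre of the
  -- unit cube.
  have hval : ∀ y : Fin d → ℤ, quadValue (R * R.transpose)
      (toReal y - R.transpose⁻¹.mulVec fun _ => 1 / 2) =
      ∑ j, ((((B.equivFun.symm y : codeLattice k) : CodeIndex k → ℤ) (e j) : ℝ) - 1 / 2) ^ 2 := by
    intro y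
    rw [quadValue_mul_transpose, mulVec_sub, mulVec_mulVec, mul_nonsing_inv _ hR0, one_mulVec]
    simp only [Pi.sub_apply, hRv]
  have hr2 : (Real.sqrt d / 2) ^ 2 = ∑ _j : Fin d, (1 / 4 : ℝ) := by
    rw [div_pow, Real.sq_sqrt (by positivity)]
    simp
    ring
  refine ⟨relVolume v, ?_, by rw [relVolume_eq_abs_det]; positivity, hd ▸ hvol⟩
  rw [hd]
  refine ⟨R * R.transpose, hpos, v,
    ⟨(affineIndependent_iff_det_edgeMatrix_ne_zero v).2 hv0,
      R.transpose⁻¹.mulVec fun _ => 1 / 2, Real.sqrt d / 2, by positivity, fun y => ?_⟩, rfl⟩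
  rw [hval, hr2]
  refine ⟨Finset.sum_le_sum fun j _ => quarter_le_sub_half_sq _, ?_⟩
  -- Each summand is at least 1/4, so equality on the sphere forces every coordinate to be 0 or 1.
  rw [eq_comm, Finset.sum_eq_sum_iff_of_le fun j _ => quarter_le_sub_half_sq _]
  constructor
  · intro h
    obtain ⟨a', ha'⟩ := exists_eq_codeword (B.equivFun.symm y).2 fun b => by
      obtain ⟨j, rfl⟩ := e.surjective b
      exact (sub_half_sq_eq_iff _).1 (h j (Finset.mem_univ _)).symm
    obtain ⟨i, hi⟩ : ∃ i, a i = a' := by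
      by_cases h0 : a' = 0
      · exact ⟨0, h0.symm⟩
      · exact ⟨(e.symm ⟨a', h0⟩).succ, by simp [a]⟩
    refine ⟨i, ?_⟩
    have hx : B.equivFun.symm y = ⟨codeword (a i), codeword_mem _⟩ := by
      ext1; rw [ha', hi]
    simp only [v, ← hx, LinearEquiv.apply_symm_apply]
  · rintro ⟨i, rfl⟩ j -
    rw [eq_comm, sub_half_sq_eq_iff]
    simp only [v, LinearEquiv.symm_apply_apply]
    exact codeword_eq_zero_or_one _ _

/-! ### Attainment and asymptotics -/

lemma exists_nat_of_mem_relVolumes {d : ℕ} {t : ℝ} (ht : t ∈ relVolumes d) :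
    ∃ n : ℕ, 1 ≤ n ∧ t = n := by
  obtain ⟨Q, -, v, hv, rfl⟩ := ht
  refine ⟨(edgeMatrix v).det.natAbs, ?_, ?_⟩
  · exact Int.natAbs_pos.2 ((affineIndependent_iff_det_edgeMatrix_ne_zero v).1 hv.1)
  · rw [relVolume_eq_abs_det, Nat.cast_natAbs, Int.cast_abs]

lemma le_of_mem_relVolumes {d : ℕ} {t : ℝ} (ht : t ∈ relVolumes d) :
    t ≤ 2 ^ d * (d.factorial : ℝ) / ((2 * d).choose d : ℝ) := by
  obtain ⟨Q, hQ, v, hv, rfl⟩ := ht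
  exact relVolume_le hQ hv

lemma bddAbove_relVolumes (d : ℕ) : BddAbove (relVolumes d) :=
  ⟨_, fun _ ht => le_of_mem_relVolumes ht⟩

lemma nonempty_relVolumes {d : ℕ} (hd : 1 ≤ d) : (relVolumes d).Nonempty := by
  obtain ⟨t, ht, -⟩ := exists_large_relVolume (k := 1) le_rfl
  exact ⟨t, relVolumes_mono (by simpa using hd) ht⟩

/-- The maximum relative volume is attained. -/
theorem isGreatest_mv {d : ℕ} (hd : 1 ≤ d) : IsGreatest (relVolumes d) (mv d) := by
  refine ⟨?_, fun t ht => le_csSup (bddAbove_relVolumes d) ht⟩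
  have hfin : (relVolumes d).Finite := by
    obtain ⟨M, hM⟩ := bddAbove_relVolumes d
    refine ((Set.finite_Iic ⌈M⌉₊).image (fun n : ℕ => (n : ℝ))).subset fun t ht => ?_
    obtain ⟨n, -, rfl⟩ := exists_nat_of_mem_relVolumes ht
    exact ⟨n, by exact_mod_cast (hM ht).trans (Nat.le_ceil M), rfl⟩
  exact (nonempty_relVolumes hd).csSup_mem hfin

lemma one_le_mv {d : ℕ} (hd : 1 ≤ d) : 1 ≤ mv d := by
  obtain ⟨n, hn, h⟩ := exists_nat_of_mem_relVolumes (isGreatest_mv hd).1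
  rw [h]
  exact_mod_cast hn

lemma mv_le {d : ℕ} (hd : 1 ≤ d) :
    mv d ≤ 2 ^ d * (d.factorial : ℝ) / ((2 * d).choose d : ℝ) :=
  le_of_mem_relVolumes (isGreatest_mv hd).1

lemma log_mv_le {d : ℕ} (hd : 1 ≤ d) : Real.log (mv d) ≤ d * Real.log d := by
  have hpos : 0 < mv d := zero_lt_one.trans_le (one_le_mv hd)
  -- This absorbs the factor 2^d of the upper bound, leaving d! ≤ d^d.
  have hchoose : (2 : ℝ) ^ d ≤ (2 * d).choose d := by
    have h : 2 ^ d ≤ (2 * d).choose d := by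
      induction d with
      | zero => simp
      | succ n ih =>
        have h1 := Nat.succ_mul_centralBinom_succ n
        rcases Nat.eq_zero_or_pos n with rfl | hn
        · decide
        · have h2 := ih hn (zero_lt_one.trans_le (one_le_mv hn))
          change 2 ^ (n + 1) ≤ Nat.centralBinom (n + 1)
          change 2 ^ n ≤ Nat.centralBinom n at h2
          refine Nat.le_of_mul_le_mul_left (c := n + 1) ?_ (by omega)
          rw [h1, pow_succ]
          nlinarith [Nat.centralBinom_pos n]
    exact_mod_cast h
  have hfac : (d.factorial : ℝ) ≤ (d : ℝ) ^ d := by exact_mod_cast Nat.factorial_le_pow d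
  have hle : mv d ≤ (d : ℝ) ^ d := by
    refine (mv_le hd).trans ?_
    have hc : (0 : ℝ) < (2 * d).choose d := lt_of_lt_of_le (by positivity) hchoose
    rw [div_le_iff₀ hc, mul_comm]
    gcongr
  calc Real.log (mv d) ≤ Real.log ((d : ℝ) ^ d) := Real.log_le_log hpos hle
    _ = d * Real.log d := by rw [Real.log_pow]

lemma le_log_mv {k d : ℕ} (hk : 8 ≤ k) (h1 : 2 ^ k ≤ d + 1) (h2 : d + 1 < 2 ^ (k + 1)) :
    1 / 16 * ((d : ℝ) * Real.log d) ≤ Real.log (mv d) := by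
  have hk1 : 1 ≤ k := by omega
  obtain ⟨t, ht, ht0, hle⟩ := exists_large_relVolume hk1
  have hdk : 2 ^ k - 1 ≤ d := by omega
  have hd1 : 1 ≤ d := by
    have : 2 ^ 8 ≤ 2 ^ k := Nat.pow_le_pow_right (by norm_num) hk
    omega
  have htm : t ≤ mv d := (isGreatest_mv hd1).2 (relVolumes_mono hdk ht)
  have hm := one_le_mv hd1
  have hmpos : 0 < mv d := zero_lt_one.trans_le hm
  have hle2 : ((2 : ℝ) ^ k) ^ (2 ^ k) ≤ (4 ^ (2 ^ k) * mv d) ^ 2 := by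
    refine hle.trans (pow_le_pow_left₀ (by positivity) ?_ 2)
    refine mul_le_mul (pow_le_pow_right₀ (by norm_num) (Nat.sub_le _ _)) htm ht0 (by positivity)
  have hlog := Real.log_le_log (by positivity) hle2
  rw [Real.log_pow, Real.log_pow, Real.log_pow, Real.log_mul (by positivity) hmpos.ne',
    Real.log_pow, show (4 : ℝ) = 2 ^ 2 by norm_num, Real.log_pow] at hlog
  push_cast at hlog
  have hl2 : 0 < Real.log 2 := Real.log_pos (by norm_num)
  have hdlog : Real.log d ≤ (k + 1) * Real.log 2 := by
    have : (d : ℝ) ≤ 2 ^ (k + 1) := by exact_mod_cast (by omega : d ≤ 2 ^ (k + 1))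
    have h := Real.log_le_log (by exact_mod_cast hd1) this
    rw [Real.log_pow] at h
    exact_mod_cast h
  have hd2 : (d : ℝ) ≤ 2 * 2 ^ k := by
    have : d ≤ 2 * 2 ^ k := by rw [pow_succ] at h2; omega
    exact_mod_cast this
  have hk8 : (8 : ℝ) ≤ k := by exact_mod_cast hk
  have hprod : (d : ℝ) * Real.log d ≤ 2 * 2 ^ k * ((k + 1) * Real.log 2) :=
    mul_le_mul hd2 hdlog (Real.log_nonneg (by exact_mod_cast hd1)) (by positivity)
  set A : ℝ := 2 ^ k * Real.log 2 with hA
  have hA0 : 0 < A := by positivity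
  have hp' : (d : ℝ) * Real.log d ≤ 2 * A * (k + 1) := by rw [hA]; linarith
  have hl' : A * k ≤ 2 * (2 * A + Real.log (mv d)) := by rw [hA]; linarith
  -- The bounds give log mv(d) ≥ A (k - 4) / 2 and d log d / 16 ≤ A (k + 1) / 8; the former
  -- dominates once k ≥ 6, so k ≥ 8 is enough.
  nlinarith [mul_le_mul_of_nonneg_left hk8 hA0.le]

/-- `log mv(d)` grows like `d log d`. -/
theorem isTheta_log_mv : Asymptotics.IsTheta Filter.atTop
    (fun d : ℕ => Real.log (mv d)) (fun d : ℕ => (d : ℝ) * Real.log (d : ℝ)) := by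
  constructor
  · refine Asymptotics.IsBigO.of_bound 1 ?_
    filter_upwards [Filter.eventually_ge_atTop 1] with d hd
    have h1 : 0 ≤ Real.log (mv d) := Real.log_nonneg (one_le_mv hd)
    rw [Real.norm_of_nonneg h1, Real.norm_of_nonneg (h1.trans (log_mv_le hd)), one_mul]
    exact log_mv_le hd
  · refine Asymptotics.IsBigO.of_bound 16 ?_
    filter_upwards [Filter.eventually_ge_atTop (2 ^ 8)] with d hd
    have hd1 : 1 ≤ d := le_trans (by norm_num) hd
    have h1 : 0 ≤ Real.log (mv d) := Real.log_nonneg (one_le_mv hd1)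
    rw [Real.norm_of_nonneg h1, Real.norm_of_nonneg (h1.trans (log_mv_le hd1))]
    have h := le_log_mv (k := Nat.log 2 (d + 1)) (d := d)
      (Nat.le_log_of_pow_le (by norm_num) (by omega))
      (Nat.pow_log_le_self 2 (by omega)) (Nat.lt_pow_succ_log_self (by norm_num) _)
    linarith

end Delone

end

theorem mainTheorem3 :
    (∀ d : ℕ, 1 ≤ d → IsGreatest (Delone.relVolumes d) (Delone.mv d)) ∧
    Asymptotics.IsTheta Filter.atTop
      (fun d : ℕ => Real.log (Delone.mv d))
      (fun d : ℕ => (d : ℝ) * Real.log (d : ℝ)) ∧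
    (∀ d : ℕ, 1 ≤ d →
      Delone.mv d ≤ (2 : ℝ) ^ d * (d.factorial : ℝ) / ((2 * d).choose d : ℝ)) :=
  ⟨fun _ hd => Delone.isGreatest_mv hd, Delone.isTheta_log_mv, fun _ hd => Delone.mv_le hd⟩
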